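/- For a compact set $D\subset\mathbb{R}^2$ with non-empty interior and an integer $n\ge 1$, let $\mathcal{P}_n$ be the space of real polynomials in two variables of total degree at most $n$, and let $\lambda_n(D,x):=\bigl(\sum_{k} p_k(x)^2\bigr)^{-1}$, $x\in D$, be the Christoffel function of $D$, where $(p_k)$ is any orthonormal basis of $\mathcal{P}_n$ with respect to the inner product $\langle f,g\rangle=\int_D f(y)g(y)\,dy$ (equivalently, $\lambda_n(D,x)=\min\{\int_D f(y)^2\,dy : f\in\mathcal{P}_n,\ f(x)=1\}$). Put $\rho_n^*(t):=n^{-2}+n^{-1}\sqrt{t}$ for $t\ge 0$, and let $|\cdot|$ be the Euclidean norm on $\mathbb{R}^2$. Let $\zeta>0$ and $0<r_1<r_2$. There is a constant $C=C(\zeta,r_1,r_2)>0$, depending only on $\zeta$, $r_1$ and $r_2$, such that the following holds for every integer $n\ge 1$ and every real $h$ with $\zeta\le h\le 1-\zeta$. Let $c_i:=(-1)^i(0,r_1h)$ and $D_i:=\{x\in\mathbb{R}^2 : r_1\le |x-c_i|\le r_2\}$ for $i=1,2$, and let $D:=D_1\cap D_2$. Then, for every $x\in D$ with $|x-c_i|\le(1+\tfrac{\zeta}{2})r_1$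 for $i=1,2$, \[ \lambda_n(D,x)\le C\,\rho_n^*(|x-c_1|-r_1)\,\rho_n^*(|x-c_2|-r_1). \] -/

import Mathlib

namespace PlanarChristoffel

open MeasureTheory

/-- The Euclidean plane. -/
abbrev Plane : Type := EuclideanSpace ℝ (Fin 2)

/-- Value of a real bivariate polynomial at a point of the plane. -/
noncomputable def value (f : MvPolynomial (Fin 2) ℝ) (x : Plane) : ℝ :=
  MvPolynomial.eval (fun i => x i) f

/-- The space `𝒫ₙ` of real polynomials in two variables of total degree at most `n`. -/
noncomputable abbrev polySpace (n : ℕ) : Submodule ℝ (MvPolynomial (Fin 2) ℝ) :=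
  MvPolynomial.restrictTotalDegree (Fin 2) ℝ n

/-- The inner product `⟨f, g⟩ = ∫_D f g` (uniform weight). -/
noncomputable def polyInner (D : Set Plane) (f g : MvPolynomial (Fin 2) ℝ) : ℝ :=
  ∫ y in D, value f y * value g y

/-- `p` is an orthonormal basis of `𝒫ₙ` with respect to `⟨f, g⟩ = ∫_D f g`. -/
structure IsOrthonormalBasis (D : Set Plane) (n : ℕ)
    (p : Fin (Module.finrank ℝ (polySpace n)) → MvPolynomial (Fin 2) ℝ) : Prop where
  orthonormal : ∀ i j, polyInner D (p i) (p j) = if i = j then 1 else 0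
  span_eq : Submodule.span ℝ (Set.range p) = polySpace n

open Classical in
/-- The Christoffel function `λₙ(D, x) = (∑ₖ pₖ(x)²)⁻¹` of `D` with the uniform weight, where
`(pₖ)` is any orthonormal basis of `𝒫ₙ`. For `D` compact with non-empty interior such a basis
exists (`exists_isOrthonormalBasis`) and the value does not depend on it (`christoffel_eq`). -/
noncomputable def christoffel (n : ℕ) (D : Set Plane) (x : Plane) : ℝ :=
  if h : ∃ p, IsOrthonormalBasis D n p then (∑ k, value (h.choose k) x ^ 2)⁻¹ else 0

/-- `ρₙ*(t) = n⁻² + n⁻¹ √t` (used for `n ≥ 1` and `t ≥ 0`). -/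
noncomputable def rhoStar (n : ℕ) (t : ℝ) : ℝ :=
  ((n : ℝ) ^ 2)⁻¹ + (n : ℝ)⁻¹ * Real.sqrt t

/-- The centers `cᵢ = (-1)ⁱ (0, r₁ h)`. -/
noncomputable def center (r₁ h : ℝ) (i : ℕ) : Plane :=
  (-1 : ℝ) ^ i • !₂[0, r₁ * h]

/-- The closed annulus `{x : r₁ ≤ |x - c| ≤ r₂}`. -/
def annulus (c : Plane) (r₁ r₂ : ℝ) : Set Plane :=
  {x | r₁ ≤ ‖x - c‖ ∧ ‖x - c‖ ≤ r₂}

/-- The intersection `D = D₁ ∩ D₂` of the two annuli centered at `c₁` and `c₂`. -/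
def twoAnnuli (r₁ r₂ h : ℝ) : Set Plane :=
  annulus (center r₁ h 1) r₁ r₂ ∩ annulus (center r₁ h 2) r₁ r₂

/-! ### Well-definedness of the Christoffel function -/

theorem continuous_value (f : MvPolynomial (Fin 2) ℝ) : Continuous (value f) := by
  unfold value
  exact (MvPolynomial.continuous_eval f).comp (by fun_prop)

theorem integrableOn_value_mul {D : Set Plane} (hD : IsCompact D)
    (f g : MvPolynomial (Fin 2) ℝ) :
    IntegrableOn (fun y => value f y * value g y) D :=
  ((continuous_value f).mul (continuous_value g)).continuousOn.integrableOn_compact hD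

theorem eq_zero_of_polyInner_self {D : Set Plane} (hD : IsCompact D)
    (hD' : (interior D).Nonempty) {f : MvPolynomial (Fin 2) ℝ} (hf : polyInner D f f = 0) :
    f = 0 := by
  have hz : ∀ y ∈ interior D, value f y = 0 := by
    have h1 : (fun y => value f y * value f y) =ᵐ[volume.restrict D] 0 :=
      (integral_eq_zero_iff_of_nonneg (fun y => mul_self_nonneg _)
        (integrableOn_value_mul hD f f)).1 hf
    have h2 : (fun y => value f y * value f y) =ᵐ[volume.restrict (interior D)] 0 :=
      ae_mono (Measure.restrict_mono interior_subset le_rfl) h1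
    have h3 := Measure.eqOn_open_of_ae_eq h2 isOpen_interior
      ((continuous_value f).mul (continuous_value f)).continuousOn continuousOn_const
    intro y hy
    exact mul_self_eq_zero.1 (h3 hy)
  obtain ⟨x, hx⟩ := hD'
  have hopen : IsOpen ((WithLp.toLp 2 : (Fin 2 → ℝ) → Plane) ⁻¹' interior D) :=
    isOpen_interior.preimage (PiLp.continuous_toLp 2 _)
  obtain ⟨ε, hε, hball⟩ := Metric.isOpen_iff.1 hopen (WithLp.ofLp x) (by simpa using hx)
  refine MvPolynomial.funext_set (fun i => Metric.ball (x i) ε) (fun i => ?_) (fun y hy => ?_)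
  · rw [Real.ball_eq_Ioo]
    exact Set.Ioo_infinite (by linarith)
  · have hy' : y ∈ Metric.ball (WithLp.ofLp x) ε := by
      rw [ball_pi _ hε]; exact hy
    simpa [value] using hz _ (hball hy')

/-- The inner product on `𝒫ₙ` given by a compact set with non-empty interior. -/
noncomputable abbrev polyCore {D : Set Plane} (hD : IsCompact D) (hD' : (interior D).Nonempty)
    (n : ℕ) : InnerProductSpace.Core ℝ (polySpace n) where
  inner f g := polyInner D f.1 g.1
  conj_inner_symm f g := by simp [polyInner, mul_comm]
  re_inner_nonneg f := integral_nonneg fun y => mul_self_nonneg _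
  add_left f g k := by
    simp only [polyInner]
    rw [← integral_add (integrableOn_value_mul hD _ _) (integrableOn_value_mul hD _ _)]
    simp [value, add_mul]
  smul_left f g r := by
    simp only [polyInner, conj_trivial]
    rw [← integral_const_mul]
    simp [value, MvPolynomial.smul_eval, mul_assoc]
  definite f hf := Subtype.ext (eq_zero_of_polyInner_self hD hD' hf)

/-- An orthonormal basis exists when `D` is compact with non-empty interior. -/
theorem exists_isOrthonormalBasis {D : Set Plane} (hD : IsCompact D)
    (hD' : (interior D).Nonempty) (n : ℕ) : ∃ p, IsOrthonormalBasis D n p := by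
  have : FiniteDimensional ℝ (polySpace n) := inferInstance
  let _ : NormedAddCommGroup (polySpace n) := (polyCore hD hD' n).toNormedAddCommGroup
  let _ : InnerProductSpace ℝ (polySpace n) := InnerProductSpace.ofCore (polyCore hD hD' n).toCore
  let b := stdOrthonormalBasis ℝ (polySpace n)
  refine ⟨fun k => (b k).1, ?_, ?_⟩
  · intro i j
    exact orthonormal_iff_ite.1 b.orthonormal i j
  · have h := b.toBasis.span_eq
    have : Set.range (fun k => (b k).1) = (polySpace n).subtype '' Set.range b.toBasis := by
      rw [← Set.range_comp]; simp [Function.comp_def]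
    rw [this, Submodule.span_image, h, Submodule.map_top, Submodule.range_subtype]

theorem polyInner_sum {D : Set Plane} (hD : IsCompact D) {n : ℕ}
    {p : Fin (Module.finrank ℝ (polySpace n)) → MvPolynomial (Fin 2) ℝ}
    (hp : IsOrthonormalBasis D n p) (a : Fin (Module.finrank ℝ (polySpace n)) → ℝ) :
    polyInner D (∑ k, a k • p k) (∑ k, a k • p k) = ∑ k, a k ^ 2 := by
  have hv : ∀ y, value (∑ k, a k • p k) y * value (∑ k, a k • p k) y =
      ∑ i, ∑ j, a i * a j * (value (p i) y * value (p j) y) := by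
    intro y
    simp only [value, map_sum, MvPolynomial.smul_eval, Finset.sum_mul_sum]
    exact Finset.sum_congr rfl fun i _ => Finset.sum_congr rfl fun j _ => by ring
  have hi : ∀ i j, Integrable (fun y => a i * a j * (value (p i) y * value (p j) y))
      (volume.restrict D) := fun i j => (integrableOn_value_mul hD _ _).const_mul _
  unfold polyInner
  simp_rw [hv]
  rw [integral_finsetSum _ fun i _ => integrable_finsetSum _ fun j _ => hi i j]
  refine Finset.sum_congr rfl fun i _ => ?_
  rw [integral_finsetSum _ fun j _ => hi i j]
  simp_rw [integral_const_mul]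
  have := hp.orthonormal i
  simp only [polyInner] at this
  simp [this, sq]

/-- For every orthonormal basis, `(∑ₖ pₖ(x)²)⁻¹` is the minimum of `∫_D f²` over `f ∈ 𝒫ₙ` with
`f(x) = 1`. -/
theorem isLeast_of_isOrthonormalBasis {D : Set Plane} (hD : IsCompact D) {n : ℕ}
    {p : Fin (Module.finrank ℝ (polySpace n)) → MvPolynomial (Fin 2) ℝ}
    (hp : IsOrthonormalBasis D n p) (x : Plane) :
    IsLeast {m : ℝ | ∃ f ∈ polySpace n, value f x = 1 ∧ m = ∫ y in D, value f y ^ 2}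
      (∑ k, value (p k) x ^ 2)⁻¹ := by
  have hsq : ∀ f, ∫ y in D, value f y ^ 2 = polyInner D f f := fun f => by
    simp [polyInner, sq]
  have hval : ∀ a : Fin (Module.finrank ℝ (polySpace n)) → ℝ,
      value (∑ k, a k • p k) x = ∑ k, a k * value (p k) x := fun a => by
    simp [value, MvPolynomial.smul_eval]
  have hcoef : ∀ f ∈ polySpace n, ∃ a : Fin (Module.finrank ℝ (polySpace n)) → ℝ,
      ∑ k, a k • p k = f := fun f hf => by
    rw [← hp.span_eq] at hf
    exact (Submodule.mem_span_range_iff_exists_fun ℝ).1 hf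
  have hcs : ∀ a : Fin (Module.finrank ℝ (polySpace n)) → ℝ, ∑ k, a k * value (p k) x = 1 →
      1 ≤ (∑ k, a k ^ 2) * ∑ k, value (p k) x ^ 2 := fun a ha => by
    have := Finset.sum_mul_sq_le_sq_mul_sq Finset.univ a (fun k => value (p k) x)
    rwa [ha, one_pow] at this
  have hS : 0 < ∑ k, value (p k) x ^ 2 := by
    obtain ⟨a, ha⟩ := hcoef 1 (by simp [MvPolynomial.mem_restrictTotalDegree])
    have h1 := hcs a (by rw [← hval, ha]; simp [value])
    rcases (Finset.sum_nonneg fun k _ => sq_nonneg (value (p k) x) :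
      0 ≤ ∑ k, value (p k) x ^ 2).eq_or_lt with h | h
    · rw [← h] at h1; norm_num at h1
    · exact h
  constructor
  · refine ⟨∑ k, ((∑ k, value (p k) x ^ 2)⁻¹ * value (p k) x) • p k, ?_, ?_, ?_⟩
    · exact Submodule.sum_mem _ fun k _ => Submodule.smul_mem _ _
        (hp.span_eq.le (Submodule.subset_span ⟨k, rfl⟩))
    · rw [hval]
      simp_rw [mul_assoc, ← sq, ← Finset.mul_sum]
      exact inv_mul_cancel₀ hS.ne'
    · rw [hsq, polyInner_sum hD hp]
      simp_rw [mul_pow, ← Finset.mul_sum]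
      field_simp
  · rintro m ⟨f, hf, hfx, rfl⟩
    obtain ⟨a, rfl⟩ := hcoef f hf
    rw [hsq, polyInner_sum hD hp]
    rw [inv_le_iff_one_le_mul₀ hS]
    exact hcs a (by rw [← hval, hfx])

/-- The value of the Christoffel function does not depend on the orthonormal basis. -/
theorem christoffel_eq {D : Set Plane} (hD : IsCompact D) {n : ℕ}
    {p : Fin (Module.finrank ℝ (polySpace n)) → MvPolynomial (Fin 2) ℝ}
    (hp : IsOrthonormalBasis D n p) (x : Plane) :
    christoffel n D x = (∑ k, value (p k) x ^ 2)⁻¹ := by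
  have h : ∃ p, IsOrthonormalBasis D n p := ⟨p, hp⟩
  rw [christoffel, dif_pos h]
  exact (isLeast_of_isOrthonormalBasis hD h.choose_spec x).unique
    (isLeast_of_isOrthonormalBasis hD hp x)

theorem isCompact_twoAnnuli (r₁ r₂ h : ℝ) : IsCompact (twoAnnuli r₁ r₂ h) := by
  have hc : ∀ c : Plane, IsClosed (annulus c r₁ r₂) := fun c =>
    have hf : Continuous fun x : Plane => ‖x - c‖ := by fun_prop
    (isClosed_le continuous_const hf).inter (isClosed_le hf continuous_const)
  refine (isCompact_closedBall (center r₁ h 1) r₂).of_isClosed_subset ((hc _).inter (hc _)) ?_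
  intro x hx
  rw [mem_closedBall_iff_norm]
  exact hx.1.2

theorem interior_twoAnnuli_nonempty {r₁ r₂ h : ℝ} (hr₁ : 0 < r₁) (hr : r₁ < r₂) (h0 : 0 ≤ h)
    (h1 : h ≤ 1) : (interior (twoAnnuli r₁ r₂ h)).Nonempty := by
  have hsub : ({x : Plane | r₁ < ‖x - center r₁ h 1‖ ∧ ‖x - center r₁ h 1‖ < r₂} ∩
      {x : Plane | r₁ < ‖x - center r₁ h 2‖ ∧ ‖x - center r₁ h 2‖ < r₂}) ⊆
      twoAnnuli r₁ r₂ h := fun x hx => ⟨⟨hx.1.1.le, hx.1.2.le⟩, ⟨hx.2.1.le, hx.2.2.le⟩⟩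
  have ho : ∀ c : Plane, IsOpen {x : Plane | r₁ < ‖x - c‖ ∧ ‖x - c‖ < r₂} := fun c =>
    have hf : Continuous fun x : Plane => ‖x - c‖ := by fun_prop
    (isOpen_lt continuous_const hf).inter (isOpen_lt hf continuous_const)
  have hsq : (r₁ * h) ^ 2 ≤ r₁ ^ 2 := by
    have : r₁ * h ≤ r₁ := by nlinarith
    exact pow_le_pow_left₀ (by positivity) this 2
  let s : ℝ := Real.sqrt (((r₁ + r₂) / 2) ^ 2 - (r₁ * h) ^ 2)
  have hs : s ^ 2 = ((r₁ + r₂) / 2) ^ 2 - (r₁ * h) ^ 2 := Real.sq_sqrt (by nlinarith)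
  have hn : ∀ i, ‖(!₂[s, 0] : Plane) - center r₁ h i‖ = (r₁ + r₂) / 2 := by
    intro i
    rw [EuclideanSpace.norm_eq, Real.sqrt_eq_iff_mul_self_eq_of_pos (by linarith), ← sq]
    rcases neg_one_pow_eq_or ℝ i with hi | hi <;>
      simp [center, hi, Fin.sum_univ_two, hs]
  refine ⟨!₂[s, 0], interior_maximal hsub ((ho _).inter (ho _)) ?_⟩
  refine ⟨⟨?_, ?_⟩, ⟨?_, ?_⟩⟩ <;> rw [hn] <;> linarith

end PlanarChristoffel

namespace PlanarChristoffel

open MeasureTheory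

/-! By the extremal characterization `isLeast_of_isOrthonormalBasis`, it suffices to exhibit one
polynomial of degree at most `n`, equal to `1` at `x`, with small `L²(D)` norm. Write `k = r₁ h`. In
the coordinates `u = |y - c₁|²`, `v = |y - c₂|²` the set `D` becomes part of the square `[r₁²,
r₂²]²`, and polynomials in `u` or `v` are polynomials in `y` of twice the degree. The test function
is `(y₀ / x₀) q₁(u) q₂(v)`, where each `qᵢ` has nearly minimal `L²` norm on `[r₁², r₂²]` given its
value `1` at `|x - cᵢ|²`.

The Jacobian of `y ↦ (u, v)` is `8 k |y₀|` in absolute value. It vanishes on the line through the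
centers, which `D` may meet when `r₂` is large; the factor `y₀` in the test function compensates for
this. On each side of that line the map is injective, so the integral is bounded by a product of two
one-variable integrals (`setIntegral_fst_sq_mul_le`). Each of these is handled by
`exists_polynomial_setIntegral_sq_le`, which is built from Fejér kernels. Division by `x₀` is
harmless because points near both inner circles stay away from the line (`sq_fst_ge_of_near`). -/

/-! ### Fejér kernels and one-variable test polynomials on an interval. -/

open Polynomial in
/-- The Fejér polynomial `(1 - T_N) / (1 - X)`. -/
theorem exists_fejer_polynomial (N : ℕ) (hN : 1 ≤ N) :
    ∃ P : ℝ[X], P.natDegree ≤ N - 1 ∧ P.eval 1 = (N : ℝ) ^ 2 ∧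
      ∀ φ : ℝ, (1 - Real.cos φ) * P.eval (Real.cos φ) = 1 - Real.cos (N * φ) := by
  have hroot : (1 - Chebyshev.T ℝ N).IsRoot 1 := by simp
  obtain ⟨R, hR⟩ := dvd_iff_isRoot.2 hroot
  have hT : (Chebyshev.T ℝ N).natDegree = N := by simp
  refine ⟨-R, ?_, ?_, fun φ => ?_⟩
  · rw [natDegree_neg]
    by_cases hR0 : R = 0
    · simp [hR0]
    have h1 : (1 - Chebyshev.T ℝ N).natDegree ≤ N := by
      refine (natDegree_sub_le _ _).trans ?_
      simp [hT]
    rw [hR, natDegree_mul (X_sub_C_ne_zero 1) hR0, natDegree_X_sub_C] at h1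
    omega
  -- Differentiating `1 - T_N = (X - 1) R` at `1` gives `R(1) = -T_N'(1) = -N²`.
  · have h := congrArg (fun p => (derivative p).eval 1) hR
    simp [derivative_mul, Chebyshev.derivative_T_eval_one] at h
    simp [← h]
  · have h := congrArg (fun p => p.eval (Real.cos φ)) hR
    simp [Chebyshev.T_real_cos] at h
    rw [eval_neg]
    linarith

theorem abs_sin_nat_mul_le (N : ℕ) (x : ℝ) : |Real.sin (N * x)| ≤ N * |Real.sin x| := by
  induction N with
  | zero => simp
  | succ N ih =>
    push_cast
    rw [add_mul, one_mul, Real.sin_add]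
    refine (abs_add_le _ _).trans ?_
    rw [abs_mul, abs_mul]
    nlinarith [mul_le_mul_of_nonneg_left (Real.abs_cos_le_one x) (abs_nonneg (Real.sin (N * x))),
      mul_le_mul_of_nonneg_right (Real.abs_cos_le_one (N * x)) (abs_nonneg (Real.sin x))]

/-- Shows that the Fejér polynomial is at most `N²`, its value at `1`, on `[-1, 1]`. -/
theorem one_sub_cos_nat_mul_le (N : ℕ) (x : ℝ) :
    1 - Real.cos (N * x) ≤ (N : ℝ) ^ 2 * (1 - Real.cos x) := by
  have key : ∀ y : ℝ, 1 - Real.cos y = 2 * |Real.sin (y / 2)| ^ 2 := fun y => by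
    have h := Real.cos_two_mul (y / 2)
    rw [mul_div_cancel₀ y two_ne_zero] at h
    rw [sq_abs, Real.sin_sq, h]; ring
  rw [key, key, mul_div_assoc]
  have := pow_le_pow_left₀ (abs_nonneg _) (abs_sin_nat_mul_le N (x / 2)) 2
  rw [mul_pow] at this
  linarith

open Polynomial in
/-- `P(cos (θ - θ₀)) + P(cos (θ + θ₀))` is a polynomial in `cos θ` of degree at most `deg P`. -/
theorem exists_polynomial_eval_cos_add (P : ℝ[X]) (α : ℝ) :
    ∃ S : ℝ[X], S.natDegree ≤ P.natDegree ∧ ∀ θ : ℝ, S.eval (Real.cos θ) =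
      P.eval (Real.cos (θ - α)) + P.eval (Real.cos (θ + α)) := by
  have hpow : ∀ k : ℕ, ∃ S : ℝ[X], S.natDegree ≤ k ∧ ∀ θ : ℝ, S.eval (Real.cos θ) =
      Real.cos (θ - α) ^ k + Real.cos (θ + α) ^ k := by
    intro k
    induction k using Nat.twoStepInduction with
    | zero => exact ⟨C 2, by simp, fun θ => by norm_num⟩
    | one =>
      refine ⟨C (2 * Real.cos α) * X, (natDegree_C_mul_le _ _).trans natDegree_X_le, fun θ => ?_⟩
      simp [Real.cos_sub, Real.cos_add]; ring
    | more k ih₁ ih₂ =>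
      obtain ⟨S₁, hd₁, h₁⟩ := ih₁
      obtain ⟨S₂, hd₂, h₂⟩ := ih₂
      -- Newton's recursion for power sums: `a^(k+2) + b^(k+2) = (a + b)(a^(k+1) + b^(k+1)) - ab(a^k
      -- + b^k)`, where `a + b` and `ab` are polynomials in `cos θ` of degrees `1` and `2`.
      refine ⟨C (2 * Real.cos α) * X * S₂ - (X ^ 2 - C (Real.sin α ^ 2)) * S₁, ?_, fun θ => ?_⟩
      · refine (natDegree_sub_le _ _).trans (max_le ?_ ?_)
        · refine natDegree_mul_le.trans ?_
          have := (natDegree_C_mul_le (2 * Real.cos α) X).trans natDegree_X_le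
          omega
        · refine natDegree_mul_le.trans ?_
          rw [natDegree_X_pow_sub_C]
          omega
      · simp only [eval_sub, eval_mul, eval_C, eval_X, eval_pow, h₁, h₂]
        have hs : Real.cos (θ - α) + Real.cos (θ + α) = 2 * Real.cos α * Real.cos θ := by
          rw [Real.cos_sub, Real.cos_add]; ring
        have hp : Real.cos (θ - α) * Real.cos (θ + α) = Real.cos θ ^ 2 - Real.sin α ^ 2 := by
          rw [Real.cos_sub, Real.cos_add]
          linear_combination (-Real.sin α ^ 2) * Real.sin_sq_add_cos_sq θ +
            Real.cos θ ^ 2 * Real.sin_sq_add_cos_sq α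
        rw [← hs, ← hp]; ring
  choose S hd hS using hpow
  refine ⟨∑ k ∈ Finset.range (P.natDegree + 1), C (P.coeff k) * S k, ?_, fun θ => ?_⟩
  · refine natDegree_sum_le_of_forall_le _ _ fun k hk => ?_
    exact (natDegree_C_mul_le _ _).trans ((hd k).trans (by simpa [Nat.lt_succ_iff] using hk))
  · rw [eval_finsetSum, eval_eq_sum_range, eval_eq_sum_range, ← Finset.sum_add_distrib]
    refine Finset.sum_congr rfl fun k _ => ?_
    rw [eval_mul, eval_C, hS]; ring

theorem integral_inv_one_add_mul_sq_le {N : ℝ} (hN : 0 < N) (a b α : ℝ) :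
    ∫ θ in a..b, (1 + (N * (θ - α)) ^ 2)⁻¹ ≤ Real.pi / N := by
  have h : ∀ θ : ℝ, HasDerivAt (fun θ => N⁻¹ * Real.arctan (N * (θ - α)))
      ((1 + (N * (θ - α)) ^ 2)⁻¹) θ := fun θ => by
    have h1 : HasDerivAt (fun θ : ℝ => N * (θ - α)) (N * 1) θ :=
      ((hasDerivAt_id θ).sub_const α).const_mul N
    refine (h1.arctan.const_mul N⁻¹).congr_deriv ?_
    field_simp
  have hc : Continuous fun θ : ℝ => (1 + (N * (θ - α)) ^ 2)⁻¹ :=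
    Continuous.inv₀ (by fun_prop) fun θ => by positivity
  rw [intervalIntegral.integral_eq_sub_of_hasDerivAt (fun θ _ => h θ) (hc.intervalIntegrable _ _),
    ← mul_sub, div_eq_inv_mul]
  refine mul_le_mul_of_nonneg_left ?_ (by positivity)
  linarith [Real.arctan_lt_pi_div_two (N * (b - α)), Real.neg_pi_div_two_lt_arctan (N * (a - α))]

/-- Lets the variation of `sin θ` away from `α` be absorbed by one factor of the kernel's decay. -/
theorem abs_le_inv_mul_one_add_sq {N : ℝ} (hN : 0 < N) (u : ℝ) :
    |u| ≤ N⁻¹ * (1 + (N * u) ^ 2) := by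
  rw [inv_mul_eq_div, le_div_iff₀ hN, mul_pow, ← sq_abs u]
  nlinarith [sq_nonneg (N * |u| - 1), abs_nonneg u, mul_nonneg hN.le (abs_nonneg u)]

/-- The reflected angle `θ + α` may exceed `π`, but `cos (θ + α) ≤ cos (θ - α)` because both sines
are nonnegative, so both kernels decay in `θ - α`. -/
theorem one_sub_cos_ge_of_mem {θ α : ℝ} (hθ : θ ∈ Set.Icc 0 Real.pi) (hα : α ∈ Set.Icc 0 Real.pi) :
    2 / Real.pi ^ 2 * (θ - α) ^ 2 ≤ 1 - Real.cos (θ - α) ∧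
      2 / Real.pi ^ 2 * (θ - α) ^ 2 ≤ 1 - Real.cos (θ + α) := by
  have h1 : Real.cos (θ - α) ≤ 1 - 2 / Real.pi ^ 2 * (θ - α) ^ 2 :=
    Real.cos_le_one_sub_mul_cos_sq (abs_le.2 ⟨by linarith [hθ.1, hα.2], by linarith [hθ.2, hα.1]⟩)
  have h2 : Real.cos (θ + α) ≤ Real.cos (θ - α) := by
    rw [Real.cos_add, Real.cos_sub]
    have := mul_nonneg (Real.sin_nonneg_of_mem_Icc hθ) (Real.sin_nonneg_of_mem_Icc hα)
    linarith
  exact ⟨by linarith, by linarith⟩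

open Polynomial in
theorem integral_sq_eval_eq_integral_cos (q : ℝ[X]) :
    ∫ x in (-1 : ℝ)..1, q.eval x ^ 2 =
      ∫ θ in (0 : ℝ)..Real.pi, q.eval (Real.cos θ) ^ 2 * Real.sin θ := by
  have h := intervalIntegral.integral_comp_mul_deriv (a := Real.pi) (b := 0)
    (f := Real.cos) (f' := fun x => -Real.sin x) (g := fun x => q.eval x ^ 2)
    (fun x _ => Real.hasDerivAt_cos x) (by fun_prop) (by fun_prop)
  rw [Real.cos_pi, Real.cos_zero] at h
  rw [← h, intervalIntegral.integral_symm, ← intervalIntegral.integral_neg]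
  simp

open Polynomial in
/-- A polynomial of degree less than `N`, equal to `1` at `x₀`, with `L²[-1, 1]` norm of the order
of the Christoffel function. -/
theorem exists_polynomial_integral_sq_le (N : ℕ) (hN : 1 ≤ N) {x₀ : ℝ} (hx₀ : x₀ ∈ Set.Icc (-1) 1) :
    ∃ q : ℝ[X], q.natDegree ≤ N - 1 ∧ q.eval x₀ = 1 ∧
      ∫ x in (-1 : ℝ)..1, q.eval x ^ 2 ≤
        4 * (1 + Real.pi ^ 2) ^ 2 * Real.pi * (((N : ℝ) ^ 2)⁻¹ + (N : ℝ)⁻¹ * √(1 - x₀ ^ 2)) := by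
  have hN0 : (0 : ℝ) < N := by exact_mod_cast hN
  obtain ⟨P, hPd, hP1, hP⟩ := exists_fejer_polynomial N hN
  set α := Real.arccos x₀ with hα
  have hcos : Real.cos α = x₀ := Real.cos_arccos hx₀.1 hx₀.2
  have hsin : Real.sin α = √(1 - x₀ ^ 2) := Real.sin_arccos x₀
  have hαm : α ∈ Set.Icc 0 Real.pi := ⟨Real.arccos_nonneg _, Real.arccos_le_pi _⟩
  obtain ⟨S, hSd, hS⟩ := exists_polynomial_eval_cos_add P α
  have hP0 : ∀ φ, 0 ≤ P.eval (Real.cos φ) ∧ P.eval (Real.cos φ) ≤ (N : ℝ) ^ 2 := fun φ => by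
    rcases (Real.cos_le_one φ).eq_or_lt with h | h
    · rw [h, hP1]; exact ⟨by positivity, le_rfl⟩
    · have h' : 0 < 1 - Real.cos φ := by linarith
      have h1 := hP φ
      have h2 := one_sub_cos_nat_mul_le N φ
      have h3 := Real.cos_le_one (N * φ)
      constructor
      · exact nonneg_of_mul_nonneg_right (by linarith) h'
      · rw [← h1, mul_comm] at h2
        exact le_of_mul_le_mul_right h2 h'
  -- The reflected kernel is nonnegative, so it cannot cancel the peak `P(1) = N²`.
  have hSx : (N : ℝ) ^ 2 ≤ S.eval x₀ := by
    rw [← hcos, hS, sub_self, Real.cos_zero, hP1]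
    linarith [(hP0 (α + α)).1]
  have hSx0 : 0 < S.eval x₀ := lt_of_lt_of_le (by positivity) hSx
  have hdecay : ∀ φ u : ℝ, 2 / Real.pi ^ 2 * u ^ 2 ≤ 1 - Real.cos φ →
      P.eval (Real.cos φ) * (1 + (N * u) ^ 2) ≤ (N : ℝ) ^ 2 * (1 + Real.pi ^ 2) := fun φ u hu => by
    have h1 : (1 - Real.cos φ) * P.eval (Real.cos φ) ≤ 2 := by
      rw [hP]; linarith [Real.neg_one_le_cos (N * φ)]
    have h2 : u ^ 2 * P.eval (Real.cos φ) ≤ Real.pi ^ 2 := by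
      have := (mul_le_mul_of_nonneg_right hu (hP0 φ).1).trans h1
      rw [mul_assoc, div_mul_eq_mul_div, div_le_iff₀ (by positivity)] at this
      linarith
    nlinarith [(hP0 φ).2, mul_le_mul_of_nonneg_left h2 (sq_nonneg (N : ℝ))]
  refine ⟨C (S.eval x₀)⁻¹ * S, ?_, ?_, ?_⟩
  · exact (natDegree_C_mul_le _ _).trans (hSd.trans hPd)
  · rw [eval_mul, eval_C, inv_mul_cancel₀ hSx0.ne']
  rw [integral_sq_eval_eq_integral_cos]
  -- The squared kernel decays like `w⁻²`; bounding `sin θ` by `(sin α + N⁻¹) w` costs one power,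
  -- and the remaining `w⁻¹` has integral at most `π / N`.
  have hpt : ∀ θ ∈ Set.Icc 0 Real.pi,
      (C (S.eval x₀)⁻¹ * S).eval (Real.cos θ) ^ 2 * Real.sin θ ≤
        4 * (1 + Real.pi ^ 2) ^ 2 * (Real.sin α + (N : ℝ)⁻¹) * (1 + (N * (θ - α)) ^ 2)⁻¹ := by
    intro θ hθ
    obtain ⟨g1, g2⟩ := one_sub_cos_ge_of_mem hθ hαm
    set w := 1 + (N * (θ - α)) ^ 2 with hw
    have hw1 : 1 ≤ w := by rw [hw]; nlinarith [sq_nonneg (N * (θ - α))]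
    have hw0 : 0 < w := by linarith
    set z := (C (S.eval x₀)⁻¹ * S).eval (Real.cos θ) with hz
    have hz' : z * S.eval x₀ = P.eval (Real.cos (θ - α)) + P.eval (Real.cos (θ + α)) := by
      rw [hz, eval_mul, eval_C, hS]
      field_simp
    have hz0 : 0 ≤ z := by
      refine nonneg_of_mul_nonneg_left ?_ hSx0
      rw [hz']; exact add_nonneg (hP0 _).1 (hP0 _).1
    have hzw : z * w ≤ 2 * (1 + Real.pi ^ 2) := by
      have e1 := hdecay _ _ g1
      have e2 := hdecay _ _ g2
      have e3 : z * (N : ℝ) ^ 2 ≤ z * S.eval x₀ := mul_le_mul_of_nonneg_left hSx hz0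
      have e4 := mul_le_mul_of_nonneg_right e3 hw0.le
      rw [hz', add_mul] at e4
      have e5 : (N : ℝ) ^ 2 * (z * w) ≤ (N : ℝ) ^ 2 * (2 * (1 + Real.pi ^ 2)) := by linarith
      exact le_of_mul_le_mul_left e5 (by positivity)
    have hsθ : Real.sin θ ≤ Real.sin α + |θ - α| := by
      linarith [le_abs_self (Real.sin θ - Real.sin α), Real.abs_sin_sub_sin_le θ α]
    have hu := abs_le_inv_mul_one_add_sq hN0 (θ - α)
    rw [← hw] at hu
    have hsα : 0 ≤ Real.sin α := Real.sin_nonneg_of_mem_Icc hαm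
    have hsw : Real.sin θ ≤ (Real.sin α + (N : ℝ)⁻¹) * w := by nlinarith
    rw [← div_eq_mul_inv, le_div_iff₀ hw0]
    have hzw2 : (z * w) ^ 2 ≤ (2 * (1 + Real.pi ^ 2)) ^ 2 :=
      pow_le_pow_left₀ (mul_nonneg hz0 hw0.le) hzw 2
    have hA : 0 ≤ Real.sin α + (N : ℝ)⁻¹ := by positivity
    calc z ^ 2 * Real.sin θ * w ≤ z ^ 2 * ((Real.sin α + (N : ℝ)⁻¹) * w) * w := by gcongr
      _ = (z * w) ^ 2 * (Real.sin α + (N : ℝ)⁻¹) := by ring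
      _ ≤ (2 * (1 + Real.pi ^ 2)) ^ 2 * (Real.sin α + (N : ℝ)⁻¹) := by gcongr
      _ = _ := by ring
  have hc : Continuous fun θ : ℝ => (1 + (N * (θ - α)) ^ 2)⁻¹ :=
    Continuous.inv₀ (by fun_prop) fun θ => by positivity
  refine (intervalIntegral.integral_mono_on Real.pi_pos.le
    (Continuous.intervalIntegrable (by fun_prop) _ _)
    ((hc.const_mul _).intervalIntegrable _ _) hpt).trans ?_
  rw [intervalIntegral.integral_const_mul, hsin]
  have hA : 0 ≤ 4 * (1 + Real.pi ^ 2) ^ 2 * (√(1 - x₀ ^ 2) + (N : ℝ)⁻¹) := by positivity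
  refine (mul_le_mul_of_nonneg_left (integral_inv_one_add_mul_sq_le hN0 _ _ _) hA).trans
    (le_of_eq ?_)
  field_simp
  ring

open Polynomial in
/-- The estimate on an interval `[A, B]`, sharp near the end point `A`. -/
theorem exists_polynomial_setIntegral_sq_le {A B : ℝ} (hAB : A < B) :
    ∃ K : ℝ, 0 < K ∧ ∀ N : ℕ, 1 ≤ N → ∀ t₀ ∈ Set.Icc A B, ∃ q : ℝ[X],
      q.natDegree ≤ N - 1 ∧ q.eval t₀ = 1 ∧
      ∫ t in Set.Icc A B, q.eval t ^ 2 ≤ K * (((N : ℝ) ^ 2)⁻¹ + (N : ℝ)⁻¹ * √(t₀ - A)) := by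
  set K₀ := 4 * (1 + Real.pi ^ 2) ^ 2 * Real.pi with hK₀
  have hK₀p : 0 < K₀ := by positivity
  set L := B - A with hL
  have hLp : 0 < L := by linarith
  refine ⟨L / 2 * K₀ * (1 + 2 / √L), by positivity, fun N hN t₀ ht₀ => ?_⟩
  -- The affine map sends `A` to `1` and `B` to `-1`. With `s = (t₀ - A) / L` one has `1 - x₀² = 4 s
  -- (1 - s) ≤ 4 s`.
  set x₀ := 1 - 2 / L * (t₀ - A) with hx₀
  have hfrac : 0 ≤ (t₀ - A) / L ∧ (t₀ - A) / L ≤ 1 :=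
    ⟨div_nonneg (by linarith [ht₀.1]) hLp.le, (div_le_one hLp).2 (by linarith [ht₀.2])⟩
  have hx₀' : x₀ = 1 - 2 * ((t₀ - A) / L) := by rw [hx₀]; ring
  obtain ⟨q, hqd, hq1, hq⟩ := exists_polynomial_integral_sq_le N hN (x₀ := x₀)
    ⟨by rw [hx₀']; linarith, by rw [hx₀']; linarith⟩
  set l : ℝ[X] := C (1 + 2 / L * A) - C (2 / L) * X with hl
  have hle : ∀ t, l.eval t = (1 + 2 / L * A) - 2 / L * t := fun t => by simp [hl]
  refine ⟨q.comp l, ?_, ?_, ?_⟩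
  · have hld : l.natDegree ≤ 1 := by
      rw [hl]
      refine (natDegree_sub_le _ _).trans (max_le ?_ ?_)
      · rw [natDegree_C]; exact zero_le_one
      · exact (natDegree_C_mul_le _ _).trans natDegree_X_le
    refine natDegree_comp_le.trans ?_
    calc q.natDegree * l.natDegree ≤ q.natDegree * 1 := Nat.mul_le_mul_left _ hld
      _ ≤ N - 1 := by omega
  · have e : 1 + 2 / L * A - 2 / L * t₀ = x₀ := by rw [hx₀]; ring
    rw [eval_comp, hle, e, hq1]
  · rw [MeasureTheory.integral_Icc_eq_integral_Ioc, ← intervalIntegral.integral_of_le hAB.le]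
    simp_rw [eval_comp, hle]
    rw [intervalIntegral.integral_comp_sub_mul (fun x => q.eval x ^ 2) (by positivity)]
    have e1 : 1 + 2 / L * A - 2 / L * B = -1 := by
      have : B = A + L := by rw [hL]; ring
      rw [this]; field_simp; ring
    have e2 : 1 + 2 / L * A - 2 / L * A = 1 := by ring
    rw [e1, e2, inv_div, smul_eq_mul]
    have hsq : √(1 - x₀ ^ 2) ≤ 2 / √L * √(t₀ - A) := by
      rw [div_mul_eq_mul_div, mul_div_assoc, ← Real.sqrt_div (by linarith [ht₀.1])]
      refine Real.sqrt_le_iff.2 ⟨by positivity, ?_⟩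
      rw [mul_pow, Real.sq_sqrt hfrac.1, hx₀']
      nlinarith [sq_nonneg ((t₀ - A) / L)]
    have hN0 : (0 : ℝ) < N := by exact_mod_cast hN
    calc L / 2 * ∫ x in (-1 : ℝ)..1, q.eval x ^ 2
        ≤ L / 2 * (K₀ * (((N : ℝ) ^ 2)⁻¹ + (N : ℝ)⁻¹ * √(1 - x₀ ^ 2))) := by gcongr
      _ ≤ L / 2 * (K₀ * (((N : ℝ) ^ 2)⁻¹ + (N : ℝ)⁻¹ * (2 / √L * √(t₀ - A)))) := by gcongr
      _ ≤ L / 2 * (K₀ * (((N : ℝ) ^ 2)⁻¹ * (1 + 2 / √L) +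
            (N : ℝ)⁻¹ * ((1 + 2 / √L) * √(t₀ - A)))) := by
          gcongr
          · exact le_mul_of_one_le_right (by positivity) (by linarith [show 0 < 2 / √L by positivity])
          · linarith
      _ = _ := by ring

/-! ### Squared distances to the centers as coordinates. -/

/-- The squared distances of a point to `(0, -k)` and `(0, k)`. -/
def sqDistMap (k : ℝ) (p : ℝ × ℝ) : ℝ × ℝ :=
  (p.1 ^ 2 + (p.2 + k) ^ 2, p.1 ^ 2 + (p.2 - k) ^ 2)

/-- The derivative of `sqDistMap`. -/
noncomputable def fderivSqDistMap (k : ℝ) (p : ℝ × ℝ) : ℝ × ℝ →L[ℝ] ℝ × ℝ :=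
  (Matrix.toLin (.finTwoProd ℝ) (.finTwoProd ℝ)
    !![2 * p.1, 2 * (p.2 + k); 2 * p.1, 2 * (p.2 - k)]).toContinuousLinearMap

theorem hasFDerivAt_sqDistMap (k : ℝ) (p : ℝ × ℝ) :
    HasFDerivAt (sqDistMap k) (fderivSqDistMap k p) p := by
  unfold fderivSqDistMap
  rw [Matrix.toLin_finTwoProd_toContinuousLinearMap]
  have h1 : HasFDerivAt (fun p : ℝ × ℝ => p.1) (ContinuousLinearMap.fst ℝ ℝ ℝ) p := hasFDerivAt_fst
  have h2 : HasFDerivAt (fun p : ℝ × ℝ => p.2) (ContinuousLinearMap.snd ℝ ℝ ℝ) p := hasFDerivAt_snd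
  convert! HasFDerivAt.prodMk (𝕜 := ℝ) ((h1.pow 2).add ((h2.add_const k).pow 2))
    ((h1.pow 2).add ((h2.sub_const k).pow 2)) using 2 <;> simp [mul_add]

theorem det_fderivSqDistMap (k : ℝ) (p : ℝ × ℝ) :
    (fderivSqDistMap k p).det = -(8 * p.1 * k) := by
  unfold fderivSqDistMap
  simp only [LinearMap.det_toContinuousLinearMap, LinearMap.det_toLin, Matrix.det_fin_two_of]
  ring

/-- The difference of the two squared distances is `4 k p.2`, which determines `p.2`. Only the sign
of `p.1` is lost. -/
theorem sq_fst_eq_of_sqDistMap_eq {k : ℝ} (hk : k ≠ 0) {p q : ℝ × ℝ}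
    (h : sqDistMap k p = sqDistMap k q) : p.1 ^ 2 = q.1 ^ 2 ∧ p.2 = q.2 := by
  simp only [sqDistMap, Prod.mk.injEq] at h
  have h2 : p.2 = q.2 := by
    have : k * (p.2 - q.2) = 0 := by linarith [h.1, h.2]
    rcases mul_eq_zero.1 this with h | h
    · exact absurd h hk
    · linarith
  refine ⟨?_, h2⟩
  rw [h2] at h
  linarith [h.1]

/-- Change of variables, enlargement of the image to the full square, then Fubini. -/
theorem setIntegral_sqDistMap_le {k A B : ℝ} {E : Set (ℝ × ℝ)}
    (hE : MeasurableSet E) (hinj : Set.InjOn (sqDistMap k) E)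
    (hmaps : Set.MapsTo (sqDistMap k) E (Set.Icc A B ×ˢ Set.Icc A B))
    {f g : ℝ → ℝ} (hf : Continuous f) (hg : Continuous g) :
    ∫ p in E, 8 * |k| * |p.1| * (f (sqDistMap k p).1 ^ 2 * g (sqDistMap k p).2 ^ 2) ≤
      (∫ t in Set.Icc A B, f t ^ 2) * ∫ t in Set.Icc A B, g t ^ 2 := by
  have h := integral_image_eq_integral_abs_det_fderiv_smul volume hE
    (fun p _ => (hasFDerivAt_sqDistMap k p).hasFDerivWithinAt) hinj
    (fun z : ℝ × ℝ => f z.1 ^ 2 * g z.2 ^ 2)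
  have e : ∀ p : ℝ × ℝ, |(fderivSqDistMap k p).det| = 8 * |k| * |p.1| := fun p => by
    rw [det_fderivSqDistMap, abs_neg, abs_mul, abs_mul, abs_of_pos (by norm_num : (0 : ℝ) < 8)]
    ring
  simp only [e, smul_eq_mul] at h
  rw [← h, ← setIntegral_prod_mul, ← Measure.volume_eq_prod]
  refine setIntegral_mono_set ?_ (Filter.Eventually.of_forall fun z => by positivity)
    (LE.le.eventuallyLE hmaps.image_subset)
  exact Continuous.continuousOn (by fun_prop) |>.integrableOn_compact
    (isCompact_Icc.prod isCompact_Icc)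

theorem measurePreserving_plane_coords :
    MeasurePreserving (fun y : Plane => ((y 0, y 1) : ℝ × ℝ)) ∧
      MeasurableEmbedding (fun y : Plane => ((y 0, y 1) : ℝ × ℝ)) := by
  have h := (EuclideanSpace.volume_preserving_symm_measurableEquiv_toLp (Fin 2)).trans
    (volume_preserving_finTwoArrow ℝ)
  exact ⟨h, (((MeasurableEquiv.toLp 2 (Fin 2 → ℝ)).symm.trans
    MeasurableEquiv.finTwoArrow).measurableEmbedding :)⟩

/-! ### Geometry of points near both inner circles. -/

theorem norm_sub_center_one_sq (r₁ h : ℝ) (x : Plane) :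
    ‖x - center r₁ h 1‖ ^ 2 = x 0 ^ 2 + (x 1 + r₁ * h) ^ 2 := by
  rw [EuclideanSpace.norm_sq_eq]
  simp [center, Fin.sum_univ_two]

theorem norm_sub_center_two_sq (r₁ h : ℝ) (x : Plane) :
    ‖x - center r₁ h 2‖ ^ 2 = x 0 ^ 2 + (x 1 - r₁ * h) ^ 2 := by
  rw [EuclideanSpace.norm_sq_eq]
  simp [center, Fin.sum_univ_two]

/-- Points close to both inner circles stay away from the line through the centers. -/
theorem sq_fst_ge_of_near {ζ r₁ h a b : ℝ} (hζ : 0 < ζ) (hr₁ : 0 < r₁) (hh : ζ ≤ h)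
    (hh' : h ≤ 1 - ζ) (l₁ : r₁ ^ 2 ≤ a ^ 2 + (b + r₁ * h) ^ 2)
    (l₂ : r₁ ^ 2 ≤ a ^ 2 + (b - r₁ * h) ^ 2)
    (u₁ : a ^ 2 + (b + r₁ * h) ^ 2 ≤ ((1 + ζ / 2) * r₁) ^ 2)
    (u₂ : a ^ 2 + (b - r₁ * h) ^ 2 ≤ ((1 + ζ / 2) * r₁) ^ 2) : r₁ ^ 2 * ζ ≤ a ^ 2 := by
  have hζ2 : ζ ≤ 1 / 2 := by linarith
  have hkl : r₁ * ζ ≤ r₁ * h := by gcongr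
  have hku : r₁ * h ≤ r₁ * (1 - ζ) := by gcongr
  -- By symmetry `β = |b|`. Subtracting the squared distances bounds `4 β r₁ h`, hence `β ≤ r₁ (1 -
  -- ζ)`. Then `β` and `r₁ h` both lie in `[0, r₁ (1 - ζ)]`, so `a² ≥ r₁² (1 - (1 - ζ)²) ≥ r₁² ζ`.
  have key : ∀ β : ℝ, 0 ≤ β → r₁ ^ 2 ≤ a ^ 2 + (β - r₁ * h) ^ 2 →
      a ^ 2 + (β + r₁ * h) ^ 2 ≤ ((1 + ζ / 2) * r₁) ^ 2 → r₁ ^ 2 * ζ ≤ a ^ 2 := by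
    intro β hβ hl hu
    have h1 : 4 * β * (r₁ * h) ≤ r₁ ^ 2 * (ζ + ζ ^ 2 / 4) := by linarith
    have h2 : (4 * β) * (r₁ * ζ) ≤ (r₁ * (1 + ζ / 4)) * (r₁ * ζ) := by
      have := mul_le_mul_of_nonneg_left hkl (by positivity : 0 ≤ 4 * β)
      linarith
    have h3 : 4 * β ≤ r₁ * (1 + ζ / 4) := le_of_mul_le_mul_right h2 (by positivity)
    have h4 : β ≤ r₁ * (1 - ζ) := by nlinarith
    have h5 : (β - r₁ * h) ^ 2 ≤ (r₁ * (1 - ζ)) ^ 2 := by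
      refine sq_le_sq' ?_ ?_
      · linarith
      · have : 0 ≤ r₁ * h := le_trans (by positivity) hkl
        linarith
    have h6 : r₁ ^ 2 * (ζ * (1 - ζ)) ≥ 0 := by
      have : 0 ≤ 1 - ζ := by linarith
      positivity
    nlinarith
  rcases le_total 0 b with hb | hb
  · exact key b hb l₂ u₁
  · refine key (-b) (by linarith) ?_ ?_
    · rw [show (-b - r₁ * h) ^ 2 = (b + r₁ * h) ^ 2 by ring]; exact l₁
    · rw [show (-b + r₁ * h) ^ 2 = (b - r₁ * h) ^ 2 by ring]; exact u₂

/-! ### The planar test polynomial and its norm on `D`. -/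

/-- The polynomial `y ↦ y₀² + (y₁ + k)²`. -/
noncomputable def sqDistPoly (k : ℝ) : MvPolynomial (Fin 2) ℝ :=
  MvPolynomial.X 0 ^ 2 + (MvPolynomial.X 1 + MvPolynomial.C k) ^ 2

theorem totalDegree_sqDistPoly_le (k : ℝ) : (sqDistPoly k).totalDegree ≤ 2 := by
  unfold sqDistPoly
  refine (MvPolynomial.totalDegree_add _ _).trans (max_le ?_ ?_)
  · refine (MvPolynomial.totalDegree_pow _ _).trans ?_
    simp
  · refine (MvPolynomial.totalDegree_pow _ _).trans ?_
    have : (MvPolynomial.X 1 + MvPolynomial.C k : MvPolynomial (Fin 2) ℝ).totalDegree ≤ 1 :=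
      (MvPolynomial.totalDegree_add _ _).trans (by simp)
    omega

theorem totalDegree_aeval_le {σ : Type*} (q : Polynomial ℝ) (p : MvPolynomial σ ℝ) :
    (Polynomial.aeval p q).totalDegree ≤ q.natDegree * p.totalDegree := by
  rw [Polynomial.aeval_eq_sum_range]
  refine (MvPolynomial.totalDegree_finsetSum_le fun k hk => ?_)
  refine (MvPolynomial.totalDegree_smul_le _ _).trans
    ((MvPolynomial.totalDegree_pow _ _).trans (Nat.mul_le_mul_right _ ?_))
  simpa [Nat.lt_succ_iff] using hk

theorem value_aeval (q : Polynomial ℝ) (p : MvPolynomial (Fin 2) ℝ) (y : Plane) :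
    value (Polynomial.aeval p q) y = q.eval (value p y) := by
  unfold value
  rw [← MvPolynomial.coe_aeval_eq_eval, RingHom.coe_coe, ← Polynomial.aeval_algHom_apply]
  simp

theorem value_sqDistPoly (k : ℝ) (y : Plane) :
    value (sqDistPoly k) y = y 0 ^ 2 + (y 1 + k) ^ 2 := by
  simp [value, sqDistPoly]

theorem twoAnnuli_eq_preimage {r₁ r₂ h : ℝ} (hr₁ : 0 < r₁) (hr : r₁ < r₂) :
    twoAnnuli r₁ r₂ h = (fun y : Plane => ((y 0, y 1) : ℝ × ℝ)) ⁻¹'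
      (sqDistMap (r₁ * h) ⁻¹' (Set.Icc (r₁ ^ 2) (r₂ ^ 2) ×ˢ Set.Icc (r₁ ^ 2) (r₂ ^ 2))) := by
  ext y
  have hr₂ : 0 ≤ r₂ := by linarith
  simp only [twoAnnuli, annulus, sqDistMap, Set.mem_inter_iff, Set.mem_ofPred_eq, Set.mem_preimage,
    Set.mem_prod, Set.mem_Icc, ← norm_sub_center_one_sq, ← norm_sub_center_two_sq,
    pow_le_pow_iff_left₀ hr₁.le (norm_nonneg _) two_ne_zero,
    pow_le_pow_iff_left₀ (norm_nonneg _) hr₂ two_ne_zero]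

/-- Of the two factors `|p.1|`, one supplies the Jacobian and the other is at most `R`. The map is
injective on each of the two half-planes, which doubles `R / (8 k)`. -/
theorem setIntegral_fst_sq_mul_le {k A B R : ℝ} (hk : 0 < k) (hR : 0 ≤ R) (hB : B ≤ R ^ 2)
    {f g : ℝ → ℝ} (hf : Continuous f) (hg : Continuous g) :
    ∫ p in sqDistMap k ⁻¹' (Set.Icc A B ×ˢ Set.Icc A B),
        p.1 ^ 2 * (f (sqDistMap k p).1 ^ 2 * g (sqDistMap k p).2 ^ 2) ≤
      R / (4 * k) * ((∫ t in Set.Icc A B, f t ^ 2) * ∫ t in Set.Icc A B, g t ^ 2) := by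
  set E := sqDistMap k ⁻¹' (Set.Icc A B ×ˢ Set.Icc A B) with hEdef
  set F : ℝ × ℝ → ℝ := fun p => p.1 ^ 2 * (f (sqDistMap k p).1 ^ 2 * g (sqDistMap k p).2 ^ 2)
    with hF
  have hcont : Continuous (sqDistMap k) := by unfold sqDistMap; fun_prop
  have hFc : Continuous F := by fun_prop
  have hEcl : IsClosed E := (isClosed_Icc.prod isClosed_Icc).preimage hcont
  have hE1 : ∀ p ∈ E, |p.1| ≤ R ∧ |p.2 + k| ≤ R := fun p hp => by
    have h1 : p.1 ^ 2 + (p.2 + k) ^ 2 ≤ B := hp.1.2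
    exact ⟨abs_le_of_sq_le_sq (by nlinarith [sq_nonneg (p.2 + k)]) hR,
      abs_le_of_sq_le_sq (by nlinarith [sq_nonneg p.1]) hR⟩
  have hEc : IsCompact E := by
    refine (isCompact_Icc (a := -R) (b := R)).prod (isCompact_Icc (a := -R - k) (b := R - k))
      |>.of_isClosed_subset hEcl fun p hp => ?_
    obtain ⟨h1, h2⟩ := hE1 p hp
    rw [abs_le] at h1 h2
    exact ⟨⟨h1.1, h1.2⟩, ⟨by linarith [h2.1], by linarith [h2.2]⟩⟩
  have hpiece : ∀ S ⊆ E, MeasurableSet S → Set.InjOn (sqDistMap k) S →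
      ∫ p in S, F p ≤
        R / (8 * k) * ((∫ t in Set.Icc A B, f t ^ 2) * ∫ t in Set.Icc A B, g t ^ 2) := by
    intro S hS hSm hinj
    refine le_trans ?_ (mul_le_mul_of_nonneg_left
      (setIntegral_sqDistMap_le hSm hinj (fun p hp => hS hp) hf hg) (by positivity))
    rw [← integral_const_mul]
    refine setIntegral_mono_on ((hFc.continuousOn.integrableOn_compact hEc).mono_set hS)
      ((Continuous.continuousOn (by fun_prop)).integrableOn_compact hEc |>.mono_set hS) hSm
      fun p hp => ?_
    have h1 := (hE1 p (hS hp)).1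
    have h2 : p.1 ^ 2 ≤ R * |p.1| := by
      rw [← sq_abs]; nlinarith [abs_nonneg p.1]
    rw [hF, abs_of_pos hk]
    calc p.1 ^ 2 * (f (sqDistMap k p).1 ^ 2 * g (sqDistMap k p).2 ^ 2)
        ≤ R * |p.1| * (f (sqDistMap k p).1 ^ 2 * g (sqDistMap k p).2 ^ 2) := by gcongr
      _ = _ := by field_simp
  have hpos : MeasurableSet {p : ℝ × ℝ | 0 ≤ p.1} := measurableSet_le measurable_const measurable_fst
  rw [← integral_inter_add_sdiff hpos (hFc.continuousOn.integrableOn_compact hEc)]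
  have i1 := hpiece (E ∩ {p | 0 ≤ p.1}) Set.inter_subset_left (hEcl.measurableSet.inter hpos)
    (fun p hp q hq hpq => by
      obtain ⟨a, b⟩ := sq_fst_eq_of_sqDistMap_eq hk.ne' hpq
      exact Prod.ext ((sq_eq_sq₀ hp.2 hq.2).1 a) b)
  have i2 := hpiece (E \ {p | 0 ≤ p.1}) Set.sdiff_subset (hEcl.measurableSet.diff hpos)
    (fun p hp q hq hpq => by
      obtain ⟨a, b⟩ := sq_fst_eq_of_sqDistMap_eq hk.ne' hpq
      have hp' : p.1 < 0 := not_le.1 hp.2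
      have hq' : q.1 < 0 := not_le.1 hq.2
      refine Prod.ext ?_ b
      rcases sq_eq_sq_iff_eq_or_eq_neg.1 a with h | h
      · exact h
      · linarith)
  refine (add_le_add i1 i2).trans (le_of_eq ?_)
  field_simp
  ring

/-- The product test polynomial controls the Christoffel function. -/
theorem christoffel_twoAnnuli_le {r₁ r₂ h : ℝ} (hr₁ : 0 < r₁) (hr : r₁ < r₂) (h0 : 0 < h)
    (h1 : h ≤ 1) {n m : ℕ} (hm : 4 * m + 1 ≤ n) {x : Plane} (hx : x 0 ≠ 0) {q₁ q₂ : Polynomial ℝ}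
    (hd₁ : q₁.natDegree ≤ m) (hd₂ : q₂.natDegree ≤ m)
    (e₁ : q₁.eval (‖x - center r₁ h 1‖ ^ 2) = 1) (e₂ : q₂.eval (‖x - center r₁ h 2‖ ^ 2) = 1) :
    christoffel n (twoAnnuli r₁ r₂ h) x ≤ r₂ / (4 * (r₁ * h) * x 0 ^ 2) *
      ((∫ t in Set.Icc (r₁ ^ 2) (r₂ ^ 2), q₁.eval t ^ 2) *
        ∫ t in Set.Icc (r₁ ^ 2) (r₂ ^ 2), q₂.eval t ^ 2) := by
  have hD := isCompact_twoAnnuli r₁ r₂ h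
  obtain ⟨p, hp⟩ := exists_isOrthonormalBasis hD (interior_twoAnnuli_nonempty hr₁ hr h0.le h1) n
  rw [christoffel_eq hD hp]
  set k := r₁ * h with hk
  have hkp : 0 < k := by positivity
  -- The degree is at most `1 + 2m + 2m`, which is where `4 * m + 1 ≤ n` comes from.
  set f : MvPolynomial (Fin 2) ℝ := (MvPolynomial.C (x 0)⁻¹ * MvPolynomial.X 0) *
    (Polynomial.aeval (sqDistPoly k) q₁ * Polynomial.aeval (sqDistPoly (-k)) q₂) with hf
  have hfv : ∀ y : Plane, value f y = ((x 0)⁻¹ * y 0) *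
      (q₁.eval (y 0 ^ 2 + (y 1 + k) ^ 2) * q₂.eval (y 0 ^ 2 + (y 1 - k) ^ 2)) := fun y => by
    have a1 := value_aeval q₁ (sqDistPoly k) y
    have a2 := value_aeval q₂ (sqDistPoly (-k)) y
    rw [value_sqDistPoly] at a1 a2
    rw [sub_eq_add_neg, ← a1, ← a2, hf]
    simp [value]
  have hfn : f ∈ polySpace n := by
    rw [MvPolynomial.mem_restrictTotalDegree]
    have d1 := (totalDegree_aeval_le q₁ (sqDistPoly k)).trans
      (Nat.mul_le_mul hd₁ (totalDegree_sqDistPoly_le k))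
    have d2 := (totalDegree_aeval_le q₂ (sqDistPoly (-k))).trans
      (Nat.mul_le_mul hd₂ (totalDegree_sqDistPoly_le (-k)))
    have d3 : (MvPolynomial.C (x 0)⁻¹ * MvPolynomial.X 0 :
        MvPolynomial (Fin 2) ℝ).totalDegree ≤ 1 :=
      (MvPolynomial.totalDegree_mul _ _).trans (by simp)
    have d4 := MvPolynomial.totalDegree_mul (Polynomial.aeval (sqDistPoly k) q₁)
      (Polynomial.aeval (sqDistPoly (-k)) q₂)
    refine (MvPolynomial.totalDegree_mul _ _).trans ?_
    omega
  have hfx : value f x = 1 := by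
    rw [hfv, ← norm_sub_center_one_sq, ← norm_sub_center_two_sq, e₁, e₂]
    field_simp
  refine ((isLeast_of_isOrthonormalBasis hD hp x).2 ⟨f, hfn, hfx, rfl⟩).trans ?_
  have hint : ∫ y in twoAnnuli r₁ r₂ h, value f y ^ 2 = (x 0 ^ 2)⁻¹ *
      ∫ p in sqDistMap k ⁻¹' (Set.Icc (r₁ ^ 2) (r₂ ^ 2) ×ˢ Set.Icc (r₁ ^ 2) (r₂ ^ 2)),
        p.1 ^ 2 * (q₁.eval (sqDistMap k p).1 ^ 2 * q₂.eval (sqDistMap k p).2 ^ 2) := by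
    rw [← integral_const_mul, ← measurePreserving_plane_coords.1.setIntegral_preimage_emb
      measurePreserving_plane_coords.2, twoAnnuli_eq_preimage hr₁ hr]
    congr 1
    ext y
    rw [hfv]
    simp only [sqDistMap]
    rw [mul_pow, mul_pow, mul_pow, inv_pow]
    ring
  rw [hint]
  have hr₂ : 0 ≤ r₂ := by linarith
  refine (mul_le_mul_of_nonneg_left (setIntegral_fst_sq_mul_le hkp hr₂ le_rfl
    q₁.continuous q₂.continuous) (by positivity)).trans (le_of_eq ?_)
  field_simp

/-- Squared radii are traded for radii by `d² - r₁² = (d + r₁)(d - r₁) ≤ 2 r₂ (d - r₁)`, and `N` for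
`n` by `N⁻¹ ≤ 4 n⁻¹`. -/
theorem endpoint_bound_le_rhoStar {n N : ℕ} (hn : 1 ≤ n) (hN : n ≤ 4 * N) {r₁ r₂ d : ℝ}
    (hr₁ : 0 < r₁) (hd : r₁ ≤ d) (hd' : d ≤ r₂) :
    ((N : ℝ) ^ 2)⁻¹ + (N : ℝ)⁻¹ * √(d ^ 2 - r₁ ^ 2) ≤
      16 * (1 + √(2 * r₂)) * rhoStar n (d - r₁) := by
  have hn0 : (0 : ℝ) < n := by exact_mod_cast hn
  have hnN : (n : ℝ) ≤ 4 * N := by exact_mod_cast hN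
  have hN0 : (0 : ℝ) < N := by linarith
  have i1 : (N : ℝ)⁻¹ ≤ 4 * (n : ℝ)⁻¹ := by
    rw [← div_eq_mul_inv, inv_eq_one_div, div_le_div_iff₀ hN0 hn0]; linarith
  have i2 : ((N : ℝ) ^ 2)⁻¹ ≤ 16 * ((n : ℝ) ^ 2)⁻¹ := by
    rw [← inv_pow, ← inv_pow]
    calc (N : ℝ)⁻¹ ^ 2 ≤ (4 * (n : ℝ)⁻¹) ^ 2 := by gcongr
      _ = _ := by ring
  have i3 : √(d ^ 2 - r₁ ^ 2) ≤ √(2 * r₂) * √(d - r₁) := by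
    rw [← Real.sqrt_mul (by linarith)]
    refine Real.sqrt_le_sqrt ?_
    nlinarith
  unfold rhoStar
  have s1 := Real.sqrt_nonneg (2 * r₂)
  have s2 := Real.sqrt_nonneg (d - r₁)
  calc _ ≤ 16 * ((n : ℝ) ^ 2)⁻¹ + 4 * (n : ℝ)⁻¹ * (√(2 * r₂) * √(d - r₁)) := by gcongr
    _ ≤ 16 * ((n : ℝ) ^ 2)⁻¹ * (1 + √(2 * r₂)) +
        16 * (n : ℝ)⁻¹ * ((1 + √(2 * r₂)) * √(d - r₁)) := by
        refine add_le_add (le_mul_of_one_le_right (by positivity) (by linarith)) ?_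
        gcongr
        · norm_num
        · linarith
    _ = _ := by ring

end PlanarChristoffel

/-! ### Assembly of the estimates. -/

theorem mainTheorem3 (ζ r₁ r₂ : ℝ) (hζ : 0 < ζ) (hr₁ : 0 < r₁) (hr : r₁ < r₂) :
    ∃ c : ℝ, 0 < c ∧ ∀ n : ℕ, 1 ≤ n → ∀ h : ℝ, ζ ≤ h → h ≤ 1 - ζ →
      ∀ x ∈ PlanarChristoffel.twoAnnuli r₁ r₂ h,
        ‖x - PlanarChristoffel.center r₁ h 1‖ ≤ (1 + ζ / 2) * r₁ →
        ‖x - PlanarChristoffel.center r₁ h 2‖ ≤ (1 + ζ / 2) * r₁ →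
        PlanarChristoffel.christoffel n (PlanarChristoffel.twoAnnuli r₁ r₂ h) x ≤
          c * PlanarChristoffel.rhoStar n (‖x - PlanarChristoffel.center r₁ h 1‖ - r₁) *
            PlanarChristoffel.rhoStar n (‖x - PlanarChristoffel.center r₁ h 2‖ - r₁) := by
  have hr₂ : 0 < r₂ := hr₁.trans hr
  obtain ⟨K, hK, hq⟩ := PlanarChristoffel.exists_polynomial_setIntegral_sq_le
    (pow_lt_pow_left₀ hr hr₁.le two_ne_zero)
  set M := K * (16 * (1 + √(2 * r₂))) with hM
  have hMp : 0 < M := by positivity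
  refine ⟨r₂ / (4 * (r₁ * ζ) * (r₁ ^ 2 * ζ)) * (M * M), by positivity,
    fun n hn h hh hh' x hx n₁ n₂ => ?_⟩
  obtain ⟨⟨l₁, m₁⟩, ⟨l₂, m₂⟩⟩ := hx
  set d₁ := ‖x - PlanarChristoffel.center r₁ h 1‖ with hd₁
  set d₂ := ‖x - PlanarChristoffel.center r₁ h 2‖ with hd₂
  have s₁ : d₁ ^ 2 = x 0 ^ 2 + (x 1 + r₁ * h) ^ 2 := PlanarChristoffel.norm_sub_center_one_sq r₁ h x
  have s₂ : d₂ ^ 2 = x 0 ^ 2 + (x 1 - r₁ * h) ^ 2 := PlanarChristoffel.norm_sub_center_two_sq r₁ h x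
  have hd₁0 : 0 ≤ d₁ := norm_nonneg _
  have hd₂0 : 0 ≤ d₂ := norm_nonneg _
  have hx0 : r₁ ^ 2 * ζ ≤ x 0 ^ 2 := by
    refine PlanarChristoffel.sq_fst_ge_of_near (h := h) (b := x 1) hζ hr₁ hh hh' ?_ ?_ ?_ ?_
    · rw [← s₁]; exact pow_le_pow_left₀ hr₁.le l₁ 2
    · rw [← s₂]; exact pow_le_pow_left₀ hr₁.le l₂ 2
    · rw [← s₁]; exact pow_le_pow_left₀ hd₁0 n₁ 2
    · rw [← s₂]; exact pow_le_pow_left₀ hd₂0 n₂ 2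
  have hx0' : x 0 ≠ 0 := fun h0 => by
    rw [h0] at hx0
    have : 0 < r₁ ^ 2 * ζ := by positivity
    norm_num at hx0
    linarith
  -- The largest `m` with `4 m + 1 ≤ n`. The one-variable estimate is used with `N = m + 1`, giving
  -- degree at most `m`, and `n ≤ 4 (m + 1)`.
  set m := (n - 1) / 4 with hm
  obtain ⟨q₁, hq₁, hv₁, hI₁⟩ := hq (m + 1) (by omega) (d₁ ^ 2)
    ⟨pow_le_pow_left₀ hr₁.le l₁ 2, pow_le_pow_left₀ hd₁0 m₁ 2⟩
  obtain ⟨q₂, hq₂, hv₂, hI₂⟩ := hq (m + 1) (by omega) (d₂ ^ 2)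
    ⟨pow_le_pow_left₀ hr₁.le l₂ 2, pow_le_pow_left₀ hd₂0 m₂ 2⟩
  have hJ₁ := hI₁.trans (mul_le_mul_of_nonneg_left (PlanarChristoffel.endpoint_bound_le_rhoStar
    (N := m + 1) hn (by omega) hr₁ l₁ m₁) hK.le)
  have hJ₂ := hI₂.trans (mul_le_mul_of_nonneg_left (PlanarChristoffel.endpoint_bound_le_rhoStar
    (N := m + 1) hn (by omega) hr₁ l₂ m₂) hK.le)
  rw [← mul_assoc, ← hM] at hJ₁ hJ₂
  have hh0 : 0 < h := hζ.trans_le hh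
  refine (PlanarChristoffel.christoffel_twoAnnuli_le hr₁ hr hh0 (by linarith) (m := m)
    (by omega) hx0' hq₁ hq₂ hv₁ hv₂).trans ?_
  have hρ₁ : 0 ≤ PlanarChristoffel.rhoStar n (d₁ - r₁) := by
    unfold PlanarChristoffel.rhoStar; positivity
  calc _ ≤ r₂ / (4 * (r₁ * ζ) * (r₁ ^ 2 * ζ)) *
        ((M * PlanarChristoffel.rhoStar n (d₁ - r₁)) *
          (M * PlanarChristoffel.rhoStar n (d₂ - r₁))) := by
        gcongr
    _ = _ := by ring
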